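/- **Conventions.** A *two-colored partition* $p$ consists of two finite (possibly empty) rows of points, an upper and a lower one, each ordered from left to right, in which every point is colored white ($\circ$) or black ($\bullet$), together with a set partition of the set of all these points into non-empty disjoint subsets, the *blocks* of $p$. Let $\mathcal P^{\circ\bullet}$ be the set of all two-colored partitions. The *tensor product* $p\otimes q$ is the horizontal concatenation of $p$ and $q$; the *involution* $p^*$ is the reflection of $p$ at the horizontal axis (colors are kept); if two partitions are such that the lower row of the one agrees in length and coloring with the upper row of the other, then their *composition* is the vertical concatenation: the two agreeing rows are identified, blocks meeting in a common point are joined, and then the points of the identified rows are erased (together with the blocks consisting only of such points). A set $\mathcal C\subseteq\mathcal P^{\circ\bullet}$ is a *category* if it contains, for each color $c$, the partition with one upper and one lower point, both of color $c$, which form one block; if it contains the two partitions without upper points, with lower row $\circ\bullet$, respectively $\bullet\circ$, and with a single block; and if it is closed under tensor products, involution and composition. Let $s$ be the partition without upper points whose lower row is $\circ\bullet$ and whose blocks are two singletons, and let $f$ be the partition without upper points whose lower row is $\circ\bullet\circ\bullet$ and which has a single block. A category $\mathcal C$ is *non-hyperoctahedral* if $s\in\mathcal C$ or $f\notin\mathcal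 C$. It is *case $\mathcal O$* if $s\notin\mathcal C$ and $f\notin\mathcal C$, *case $\mathcal B$* if $s\in\mathcal C$ and $f\notin\mathcal C$, and *case $\mathcal S$* if $s\in\mathcal C$ and $f\in\mathcal C$. Put $$F(\mathcal C):=\{|B| \;:\; p\in\mathcal C,\ B\text{ a block of }p\},\qquad \mathbb N:=\{1,2,3,\dots\}.$$ **Proposition 4.3.** Let $\mathcal C\subseteq\mathcal P^{\circ\bullet}$ be a non-hyperoctahedral category. (a) The set $F(\mathcal C)$ is $\{2\}$, $\{1,2\}$ or $\mathbb N$. (b) If $\mathcal C$ is case $\mathcal O$, then $F(\mathcal C)=\{2\}$. (c) If $\mathcal C$ is case $\mathcal B$, then $F(\mathcal C)=\{1,2\}$. (d) If $\mathcal C$ is case $\mathcal S$, then $F(\mathcal C)=\mathbb N$. -/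

import Mathlib

namespace TwoColored

/-- The two colors of points: white and black. -/
inductive Color
  | white
  | black

/-- The set of points of a partition with upper row colored (from left to right) by `a` and lower
row colored by `b`: the upper points `Sum.inl i` and the lower points `Sum.inr j`. -/
abbrev Points (a b : List Color) : Type := Fin a.length ⊕ Fin b.length

/-- A two-colored partition: finite (possibly empty) upper and lower rows of colored points,
together with a set partition (given as an equivalence relation) of the set of all points. -/
structure Partition where
  upper : List Color
  lower : List Color
  rel : Setoid (Points upper lower)

namespace Partition

/-- The blocks of a two-colored partition. -/
def blocks (p : Partition) : Set (Set (Points p.upper p.lower)) := p.rel.classes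

end Partition

/-- The points of a row colored by `a ++ c` are the points of `a` followed by those of `c`. -/
def splitRow (a c : List Color) (i : Fin (a ++ c).length) : Fin a.length ⊕ Fin c.length :=
  if h : i.val < a.length then Sum.inl ⟨i.val, h⟩
  else Sum.inr ⟨i.val - a.length, by
    have := i.isLt.trans_eq List.length_append
    omega⟩

/-- In the horizontal concatenation of two partitions, every point comes either from the left
or from the right partition. -/
def splitPoints (a b c d : List Color) :
    Points (a ++ c) (b ++ d) → Points a b ⊕ Points c d
  | Sum.inl i => Sum.map Sum.inl Sum.inl (splitRow a c i)
  | Sum.inr j => Sum.map Sum.inr Sum.inr (splitRow b d j)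

/-- The disjoint union of two set partitions. -/
def disjointUnion {α β : Type} (p : Setoid α) (q : Setoid β) : Setoid (α ⊕ β) where
  r := Sum.LiftRel p q
  iseqv :=
    { refl := by
        rintro (x | x)
        · exact Sum.LiftRel.inl (p.refl x)
        · exact Sum.LiftRel.inr (q.refl x)
      symm := by
        rintro _ _ (h | h)
        · exact Sum.LiftRel.inl (p.symm h)
        · exact Sum.LiftRel.inr (q.symm h)
      trans := by
        rintro _ _ _ (h | h) (h' | h')
        · exact Sum.LiftRel.inl (p.trans h h')
        · exact Sum.LiftRel.inr (q.trans h h') }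

/-- The tensor product `p ⊗ q`: horizontal concatenation, `q` to the right of `p`. -/
def tensor {a b c d : List Color} (p : Setoid (Points a b)) (q : Setoid (Points c d)) :
    Setoid (Points (a ++ c) (b ++ d)) :=
  (disjointUnion p q).comap (splitPoints a b c d)

/-- The involution `p*`: reflection at the horizontal axis; colors are kept. -/
def adjoint {a b : List Color} (p : Setoid (Points a b)) : Setoid (Points b a) :=
  p.comap Sum.swap

/-- Stack `p` on top of `q`, identifying the lower row of `p` with the upper row of `q`. The three
rows are `Sum.inl i` (top), `Sum.inr (Sum.inl j)` (middle) and `Sum.inr (Sum.inr k)` (bottom).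
Two points are linked directly if they lie in a common block of `p` or in a common block of `q`. -/
inductive Linked {a b c : List Color} (p : Setoid (Points a b)) (q : Setoid (Points b c)) :
    Fin a.length ⊕ (Fin b.length ⊕ Fin c.length) →
      Fin a.length ⊕ (Fin b.length ⊕ Fin c.length) → Prop
  | above {x y : Points a b} (h : p x y) :
      Linked p q (Sum.map id Sum.inl x) (Sum.map id Sum.inl y)
  | below {x y : Points b c} (h : q x y) : Linked p q (Sum.inr x) (Sum.inr y)

/-- The vertical concatenation of `p` (on top) and `q` (below): two of the remaining (top or
bottom) points are in the same block if and only if they are connected by a chain of blocks of `p`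
and `q`. The points of the middle row are erased. -/
def compose {a b c : List Color} (p : Setoid (Points a b)) (q : Setoid (Points b c)) :
    Setoid (Points a c) :=
  (Relation.EqvGen.setoid (Linked p q)).comap (Sum.map id Sum.inr)

/-- The identity partition of a point of color `x`: one upper and one lower point, both of color
`x`, in one block. -/
def idPart (x : Color) : Partition := ⟨[x], [x], ⊤⟩

/-- The pair partition with no upper points and lower row colored `x`, `y`. -/
def pairPart (x y : Color) : Partition := ⟨[], [x, y], ⊤⟩

/-- The two singletons: no upper points, lower row colored white, black, two singleton blocks. -/
def singles : Partition := ⟨[], [Color.white, Color.black], ⊥⟩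

/-- The four block: no upper points, lower row colored white, black, white, black, one block. -/
def fourBlock : Partition :=
  ⟨[], [Color.white, Color.black, Color.white, Color.black], ⊤⟩

/-- A category of two-colored partitions. -/
structure IsCategory (C : Set Partition) : Prop where
  id_mem : ∀ x : Color, idPart x ∈ C
  pair_white_black_mem : pairPart Color.white Color.black ∈ C
  pair_black_white_mem : pairPart Color.black Color.white ∈ C
  tensor_mem : ∀ {a b c d : List Color} (p : Setoid (Points a b)) (q : Setoid (Points c d)),
    ⟨a, b, p⟩ ∈ C → ⟨c, d, q⟩ ∈ C → ⟨a ++ c, b ++ d, tensor p q⟩ ∈ C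
  adjoint_mem : ∀ {a b : List Color} (p : Setoid (Points a b)),
    ⟨a, b, p⟩ ∈ C → ⟨b, a, adjoint p⟩ ∈ C
  compose_mem : ∀ {a b c : List Color} (p : Setoid (Points a b)) (q : Setoid (Points b c)),
    ⟨a, b, p⟩ ∈ C → ⟨b, c, q⟩ ∈ C → ⟨a, c, compose p q⟩ ∈ C

/-- Case `𝒪`. -/
def CaseO (C : Set Partition) : Prop := singles ∉ C ∧ fourBlock ∉ C

/-- Case `ℬ`. -/
def CaseB (C : Set Partition) : Prop := singles ∈ C ∧ fourBlock ∉ C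

/-- Case `𝒮`. -/
def CaseS (C : Set Partition) : Prop := singles ∈ C ∧ fourBlock ∈ C

/-- The property that distinguishes the non-hyperoctahedral categories among all categories. -/
def NonHyperoctahedral (C : Set Partition) : Prop := singles ∈ C ∨ fourBlock ∉ C

/-- The set `F(C)` of block sizes appearing in `C`. -/
def blockSizes (C : Set Partition) : Set ℕ :=
  {n | ∃ p ∈ C, ∃ B ∈ p.blocks, B.ncard = n}

end TwoColored

namespace TwoColored

open Relation

/-! Tensoring with an identity strand and contracting neighboring points of opposite colors rotates
an outer point into the other row and flips its color. Hence any point of a block can be made the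
only lower point. Stacking `p*` on `p` then doubles the lower row, and a block is joined to its
mirror image exactly when it meets the erased row (`compose_adjoint`).

A block of size 1 thus yields two singletons, i.e. `singles` (`singles_mem`); a block of size at
least 3 yields, after two such doublings, `fourBlock` (`fourBlock_mem`). Conversely, pairs are
always present, `singles` has block size 1, contracting copies of `fourBlock` gives all even sizes,
and contracting one point against a singleton gives all odd ones. So `singles` and `fourBlock`
determine the block sizes.

The calculus is carried out on rows of labelled points, where equal labels mean the same block;
composition then becomes a relabelling (`compose_part`). -/

/-- The opposite color. -/
def Color.flip : Color → Color
  | .white => .black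
  | .black => .white

@[simp] theorem Color.flip_flip (c : Color) : c.flip.flip = c := by cases c <;> rfl

/-- Two partitions agree if their rows agree and their relations agree along the identification of
the rows. -/
theorem mk_ext {a b a' b' : List Color} {r : Setoid (Points a b)} {r' : Setoid (Points a' b')}
    (ha : a = a') (hb : b = b')
    (h : ∀ x y : Points a b, r x y ↔
      r' (Sum.map (Fin.cast (congrArg List.length ha)) (Fin.cast (congrArg List.length hb)) x)
        (Sum.map (Fin.cast (congrArg List.length ha)) (Fin.cast (congrArg List.length hb)) y)) :
    (⟨a, b, r⟩ : Partition) = ⟨a', b', r'⟩ := by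
  subst ha hb
  congr 1
  ext x y
  have := h x y
  rcases x with x | x <;> rcases y with y | y <;> simpa using this

/-! ### Partitions as labelled rows -/

section Labels

variable {L M N : Type}

/-- The label of a point in a row of colored and labelled points. -/
def rowLabel (u : List (Color × L)) (i : Fin (u.map Prod.fst).length) : L :=
  (u[i.val]'(by simpa using i.isLt)).2

/-- The label of a point of a pair of rows of colored and labelled points. -/
def label (u l : List (Color × L)) : Points (u.map Prod.fst) (l.map Prod.fst) → L :=
  Sum.elim (rowLabel u) (rowLabel l)

/-- The partition given by two rows of labelled points: points with equal labels form a block. -/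
def part (u l : List (Color × L)) : Partition :=
  ⟨u.map Prod.fst, l.map Prod.fst, Setoid.ker (label u l)⟩

/-- Change of the labels of a row. -/
abbrev relabel (f : L → M) (u : List (Color × L)) : List (Color × M) := u.map (Prod.map id f)

/-- The occurrence of a label in a row. -/
def Occurs (t : L) (u : List (Color × L)) : Prop := t ∈ u.map Prod.snd

theorem rowLabel_occurs (u : List (Color × L)) (i) : Occurs (rowLabel u i) u := by
  simp only [Occurs, rowLabel]
  exact List.mem_map_of_mem (List.getElem_mem _)

theorem rowLabel_relabel (f : L → M) (u : List (Color × L)) (i) :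
    rowLabel (relabel f u) i = f (rowLabel u (Fin.cast (by simp) i)) := by
  simp [rowLabel]

theorem part_relabel {f : L → M} (hf : Function.Injective f) (u l : List (Color × L)) :
    part (relabel f u) (relabel f l) = part u l := by
  refine mk_ext (by simp) (by simp) ?_
  rintro (x | x) (y | y) <;> simp [label, Setoid.ker_def, rowLabel_relabel, hf.eq_iff]

/-- Every two-colored partition is given by labels. -/
theorem exists_part (p : Partition) :
    ∃ u l : List (Color × Quotient p.rel), part u l = p := by
  obtain ⟨a, b, r⟩ := p
  let u : List (Color × Quotient r) :=
    List.ofFn fun i : Fin a.length => (a[i], Quotient.mk r (Sum.inl i))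
  let l : List (Color × Quotient r) :=
    List.ofFn fun i : Fin b.length => (b[i], Quotient.mk r (Sum.inr i))
  have hu : u.map Prod.fst = a := by
    simp only [u, List.map_ofFn]; exact List.ofFn_getElem
  have hl : l.map Prod.fst = b := by
    simp only [l, List.map_ofFn]; exact List.ofFn_getElem
  refine ⟨u, l, mk_ext hu hl ?_⟩
  rintro (x | x) (y | y) <;>
    simp [label, Setoid.ker_def, rowLabel, u, l, Quotient.eq] <;> rfl

theorem adjoint_part {C : Set Partition} (hC : IsCategory C) {u l : List (Color × L)}
    (h : part u l ∈ C) : part l u ∈ C := by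
  convert hC.adjoint_mem _ h using 1
  refine mk_ext rfl rfl ?_
  rintro (x | x) (y | y) <;> rfl

theorem rowLabel_append (u v : List (Color × L)) (i) :
    rowLabel (u ++ v) i = Sum.elim (rowLabel u) (rowLabel v)
      (splitRow (u.map Prod.fst) (v.map Prod.fst) (Fin.cast (by simp) i)) := by
  unfold splitRow
  split_ifs with h
  · have h' : i.val < u.length := by simpa using h
    simp [rowLabel, List.getElem_append_left h']
  · have h' : u.length ≤ i.val := by simpa using h
    simp [rowLabel, List.getElem_append_right h']

theorem tensor_part {C : Set Partition} (hC : IsCategory C) {u l u' l' : List (Color × L)}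
    (h : part u l ∈ C) (h' : part u' l' ∈ C)
    (hd : ∀ t, Occurs t u ∨ Occurs t l → ¬ (Occurs t u' ∨ Occurs t l')) :
    part (u ++ u') (l ++ l') ∈ C := by
  convert hC.tensor_mem _ _ h h' using 1
  refine mk_ext (by simp) (by simp) ?_
  have key : ∀ z : Points ((u ++ u').map Prod.fst) ((l ++ l').map Prod.fst),
      label (u ++ u') (l ++ l') z = Sum.elim (label u l) (label u' l')
        (splitPoints (u.map Prod.fst) (l.map Prod.fst) (u'.map Prod.fst) (l'.map Prod.fst)
          (Sum.map (Fin.cast (by simp)) (Fin.cast (by simp)) z)) := by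
    rintro (z | z) <;> simp only [label, Sum.elim_inl, Sum.elim_inr, rowLabel_append,
      Sum.map_inl, Sum.map_inr, splitPoints] <;>
    · generalize splitRow _ _ _ = w
      rcases w with w | w <;> rfl
  have occ : ∀ (u l : List (Color × L)) z, Occurs (label u l z) u ∨ Occurs (label u l z) l := by
    rintro u l (z | z)
    · exact Or.inl (rowLabel_occurs u z)
    · exact Or.inr (rowLabel_occurs l z)
  intro x y
  change label _ _ x = label _ _ y ↔ Sum.LiftRel _ _ _ _
  rw [key, key]
  generalize splitPoints _ _ _ _ _ = X
  generalize splitPoints _ _ _ _ _ = Y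
  rcases X with X | X <;> rcases Y with Y | Y
  · simp [Setoid.ker_def]
  · simp only [Sum.elim_inl, Sum.elim_inr, Sum.not_liftRel_inl_inr, iff_false]
    intro e
    exact hd _ (occ u l X) (e ▸ occ u' l' Y)
  · simp only [Sum.elim_inl, Sum.elim_inr, Sum.not_liftRel_inr_inl, iff_false]
    intro e
    exact hd _ (occ u l Y) (e ▸ occ u' l' X)
  · simp [Setoid.ker_def]

/-- The labels of the two middle rows that are identified in a composition. -/
def Glued (m : List (Color × L)) (m' : List (Color × M)) (j k : L ⊕ M) : Prop :=
  ∃ s t, j = Sum.inl s ∧ k = Sum.inr t ∧ (s, t) ∈ (m.map Prod.snd).zip (m'.map Prod.snd)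

/-- The maps `f` and `g` name the components of the stack: `hm` makes the names constant along
links, and `hconn` ensures that equal names are really connected. It is only required for labels of
the outer rows, since all other components are erased. -/
theorem compose_part {C : Set Partition} (hC : IsCategory C) {u m : List (Color × L)}
    {m' l : List (Color × M)} (h : part u m ∈ C) (h' : part m' l ∈ C) (f : L → N) (g : M → N)
    (hm : relabel f m = relabel g m')
    (hconn : ∀ j k : L ⊕ M, Sum.elim (Occurs · u) (Occurs · l) j →
      Sum.elim (Occurs · u) (Occurs · l) k → Sum.elim f g j = Sum.elim f g k →
      EqvGen (Glued m m') j k) :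
    part (relabel f u) (relabel g l) ∈ C := by
  have hmc : m.map Prod.fst = m'.map Prod.fst := by
    simpa [Function.comp_def] using congrArg (List.map Prod.fst) hm
  have hlen : m.length = m'.length := by simpa using congrArg List.length hmc
  have hlen' : (m.map Prod.fst).length = (m'.map Prod.fst).length := by simpa using hlen
  -- Composition needs the same middle row on both sides, so the lower partition is transported
  -- along the equality of colors.
  let q : Setoid (Points (m.map Prod.fst) (l.map Prod.fst)) :=
    Setoid.ker (Sum.elim (fun i => rowLabel m' (Fin.cast hlen' i)) (rowLabel l))
  have hq : part m' l = ⟨m.map Prod.fst, l.map Prod.fst, q⟩ := by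
    refine mk_ext hmc.symm rfl ?_
    rintro (x | x) (y | y) <;> rfl
  rw [hq] at h'
  have hcomp := hC.compose_mem _ _ h h'
  convert hcomp using 1
  refine mk_ext (by simp) (by simp) ?_
  have hmid : ∀ i, f (rowLabel m i) = g (rowLabel m' (Fin.cast hlen' i)) := by
    intro i
    have hi : i.val < m.length := by simpa using i.isLt
    have hi' : i.val < m'.length := hlen ▸ hi
    have e : (relabel f m)[i.val]? = (relabel g m')[i.val]? := by rw [hm]
    simp only [relabel, List.getElem?_map, List.getElem?_eq_getElem hi,
      List.getElem?_eq_getElem hi', Option.map_some, Option.some.injEq] at e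
    exact congrArg Prod.snd e
  let lam : Fin (u.map Prod.fst).length ⊕ (Fin (m.map Prod.fst).length ⊕
      Fin (l.map Prod.fst).length) → N :=
    Sum.elim (fun i => f (rowLabel u i))
      (Sum.elim (fun i => f (rowLabel m i)) (fun i => g (rowLabel l i)))
  let R := Linked (Setoid.ker (label u m)) q
  have sound : ∀ x y, EqvGen R x y → lam x = lam y := by
    intro x y hxy
    induction hxy with
    | rel x y hxy =>
      cases hxy with
      | @above x y h =>
        have h : label u m x = label u m y := h
        rcases x with x | x <;> rcases y with y | y <;> exact congrArg f h
      | @below x y h =>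
        rcases x with x | x <;> rcases y with y | y <;>
          simp only [lam, Sum.elim_inr, Sum.elim_inl, hmid] <;> exact congrArg g h
    | refl => rfl
    | symm _ _ _ ih => exact ih.symm
    | trans _ _ _ _ _ ih ih' => exact ih.trans ih'
  -- `P j` is the block labelled `j`, seen inside the three-row stack.
  let P : L ⊕ M → Set (Fin (u.map Prod.fst).length ⊕ (Fin (m.map Prod.fst).length ⊕
      Fin (l.map Prod.fst).length)) :=
    Sum.elim (fun s => {x | ∃ z, label u m z = s ∧ x = Sum.map id Sum.inl z})
      (fun t => {x | ∃ z, Sum.elim (fun i => rowLabel m' (Fin.cast hlen' i)) (rowLabel l) z = t ∧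
        x = Sum.inr z})
  have same : ∀ j x y, x ∈ P j → y ∈ P j → EqvGen R x y := by
    rintro (s | t) x y ⟨z, hz, rfl⟩ ⟨w, hw, rfl⟩
    · exact .rel _ _ (.above (hz.trans hw.symm))
    · exact .rel _ _ (.below (hz.trans hw.symm))
  -- Nonemptiness is carried along because transitivity needs a point in the intermediate block.
  have complete : ∀ j k, EqvGen (Glued m m') j k →
      ((P j).Nonempty ↔ (P k).Nonempty) ∧ ∀ x ∈ P j, ∀ y ∈ P k, EqvGen R x y := by
    intro j k hjk
    induction hjk with
    | rel j k hjk =>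
      obtain ⟨s, t, rfl, rfl, hst⟩ := hjk
      obtain ⟨i, hi, e⟩ := List.getElem_of_mem hst
      simp only [List.getElem_zip, Prod.mk.injEq, List.getElem_map] at e
      simp only [List.length_zip, List.length_map, lt_inf_iff] at hi
      let i' : Fin (m.map Prod.fst).length := ⟨i, by simpa using hi.1⟩
      have h1 : (Sum.inr (Sum.inl i') : _ ⊕ (_ ⊕ _)) ∈ P (Sum.inl s) := ⟨Sum.inr i', e.1, rfl⟩
      have h2 : (Sum.inr (Sum.inl i') : _ ⊕ (_ ⊕ _)) ∈ P (Sum.inr t) := ⟨Sum.inl i', e.2, rfl⟩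
      exact ⟨⟨fun _ => ⟨_, h2⟩, fun _ => ⟨_, h1⟩⟩, fun x hx y hy =>
        .trans _ _ _ (same _ _ _ hx h1) (same _ _ _ h2 hy)⟩
    | refl j => exact ⟨Iff.rfl, fun x hx y hy => same _ _ _ hx hy⟩
    | symm _ _ _ ih => exact ⟨ih.1.symm, fun x hx y hy => .symm _ _ (ih.2 y hy x hx)⟩
    | trans _ _ _ _ _ ih ih' =>
      refine ⟨ih.1.trans ih'.1, fun x hx y hy => ?_⟩
      obtain ⟨z, hz⟩ := ih.1.1 ⟨x, hx⟩
      exact .trans _ _ _ (ih.2 x hx z hz) (ih'.2 z hz y hy)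
  let O : Points (u.map Prod.fst) (l.map Prod.fst) → L ⊕ M := Sum.map (rowLabel u) (rowLabel l)
  have hO : ∀ z, Sum.elim (Occurs · u) (Occurs · l) (O z) := by
    rintro (z | z)
    · exact rowLabel_occurs u z
    · exact rowLabel_occurs l z
  have hP : ∀ z, Sum.map id Sum.inr z ∈ P (O z) := by
    rintro (z | z)
    · exact ⟨Sum.inl z, rfl, rfl⟩
    · exact ⟨Sum.inr z, rfl, rfl⟩
  have hlam : ∀ z, lam (Sum.map id Sum.inr z) = Sum.elim f g (O z) := by
    rintro (z | z) <;> rfl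
  have main : ∀ x y : Points (u.map Prod.fst) (l.map Prod.fst),
      Sum.elim f g (O x) = Sum.elim f g (O y) ↔
        EqvGen R (Sum.map id Sum.inr x) (Sum.map id Sum.inr y) := by
    intro x y
    refine ⟨fun e => (complete _ _ (hconn _ _ (hO x) (hO y) e)).2 _ (hP x) _ (hP y), fun e => ?_⟩
    rw [← hlam, ← hlam]
    exact sound _ _ e
  intro x y
  refine Iff.trans ?_ (main _ _)
  rcases x with x | x <;> rcases y with y | y <;>
    simp [label, Setoid.ker_def, rowLabel_relabel, O]

end Labels

/-! ### Contraction, rotation and doubling -/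

section Rotation

variable {L M N : Type} {C : Set Partition}

@[simp] theorem occurs_nil (t : L) : ¬ Occurs t [] := by simp [Occurs]

@[simp] theorem occurs_cons (t : L) (x : Color × L) (u : List (Color × L)) :
    Occurs t (x :: u) ↔ t = x.2 ∨ Occurs t u := by simp [Occurs]

@[simp] theorem occurs_append (t : L) (u v : List (Color × L)) :
    Occurs t (u ++ v) ↔ Occurs t u ∨ Occurs t v := by
  simp only [Occurs, List.map_append, List.mem_append]

theorem part_of_const {u l : List (Color × L)} {t : L} (hu : ∀ x ∈ u, x.2 = t)
    (hl : ∀ x ∈ l, x.2 = t) : part u l = ⟨u.map Prod.fst, l.map Prod.fst, ⊤⟩ := by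
  unfold part
  congr 1
  ext x y
  have : ∀ z, label u l z = t := by
    rintro (z | z)
    · exact hu _ (List.getElem_mem _)
    · exact hl _ (List.getElem_mem _)
  simp [Setoid.ker_def, this, Setoid.top_def]

theorem singles_eq {s t : L} (h : s ≠ t) :
    singles = part [] [(Color.white, s), (Color.black, t)] := by
  refine mk_ext rfl rfl ?_
  rintro (x | x) (y | y)
  · exact x.elim0
  · exact x.elim0
  · exact y.elim0
  · fin_cases x <;> fin_cases y <;> simp [Setoid.ker_def, label, rowLabel, h, h.symm]

theorem pair_mem (hC : IsCategory C) (c : Color) (t : L) :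
    part [] [(c, t), (c.flip, t)] ∈ C := by
  rw [part_of_const (t := t) (by simp) (by simp)]
  cases c
  · exact hC.pair_white_black_mem
  · exact hC.pair_black_white_mem

theorem id_mem (hC : IsCategory C) (c : Color) (t : L) : part [(c, t)] [(c, t)] ∈ C := by
  rw [part_of_const (t := t) (by simp) (by simp)]
  exact hC.id_mem c

/-- A pair stacked on its adjoint leaves only a closed loop, which is erased. -/
theorem empty_mem (hC : IsCategory C) : part ([] : List (Color × L)) [] ∈ C := by
  have h := pair_mem hC .white ()
  convert hC.compose_mem _ _ h (hC.adjoint_mem _ h) using 1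
  refine mk_ext rfl rfl ?_
  rintro (x | x) <;> exact x.elim0

/-- A row with all labels made different. -/
def separate (n : ℕ) (u : List (Color × L)) : List (Color × Option (ℕ × L)) :=
  match u with
  | [] => []
  | x :: u => (x.1, some (n, x.2)) :: separate (n + 1) u

theorem separate_occurs {n : ℕ} {u : List (Color × L)} {k : Option (ℕ × L)}
    (h : Occurs k (separate n u)) : ∃ i t, k = some (i, t) ∧ n ≤ i ∧ i < n + u.length ∧
      (t, k) ∈ (u.map Prod.snd).zip ((separate n u).map Prod.snd) := by
  induction u generalizing n with
  | nil => simp [separate] at h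
  | cons x u ih =>
    simp only [separate, occurs_cons] at h
    rcases h with rfl | h
    · exact ⟨n, x.2, rfl, le_rfl, by simp, by simp [separate]⟩
    · obtain ⟨i, t, rfl, h1, h2, h3⟩ := ih h
      exact ⟨i, t, rfl, by omega, by simp only [List.length_cons]; omega,
        by simp only [separate, List.map_cons, List.zip_cons_cons]; exact List.mem_cons_of_mem _ h3⟩

theorem separate_length (n : ℕ) (u : List (Color × L)) : (separate n u).length = u.length := by
  induction u generalizing n with
  | nil => rfl
  | cons x u ih => simp [separate, ih]

/-- The default `d` is irrelevant because `none` never labels a point of a separated row. -/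
theorem relabel_separate (n : ℕ) (u : List (Color × L)) (f : L → M) (d : M) :
    relabel (fun k => k.elim d fun k => f k.2) (separate n u) = relabel f u := by
  induction u generalizing n with
  | nil => rfl
  | cons x u ih => exact congrArg _ (ih (n + 1))

theorem separate_mem (hC : IsCategory C) (n : ℕ) (u : List (Color × L)) :
    part (separate n u) (separate n u) ∈ C := by
  induction u generalizing n with
  | nil => exact empty_mem hC
  | cons x u ih =>
    refine tensor_part hC (id_mem hC x.1 (some (n, x.2))) (ih (n + 1)) ?_
    rintro t ht ht'
    simp only [occurs_cons, occurs_nil, or_false, or_self] at ht ht'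
    obtain ⟨i, t', e, h1, -⟩ := separate_occurs ht'
    rw [ht] at e
    simp only [Option.some.injEq, Prod.mk.injEq] at e
    omega

/-- Contraction of two neighboring points of opposite colors in the lower row. -/
theorem contract (hC : IsCategory C) {u l₁ l₂ : List (Color × L)} {c : Color} {s s' : L}
    (h : part u (l₁ ++ (c, s) :: (c.flip, s') :: l₂) ∈ C) (f : L → M) (hs : f s = f s')
    (hf : ∀ a b, f a = f b → a = b ∨ (a = s ∧ b = s') ∨ (a = s' ∧ b = s)) :
    part (relabel f u) (relabel f (l₁ ++ l₂)) ∈ C := by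
  set n := l₁.length
  have hsep1 := separate_mem hC 0 l₁
  have hsep2 := separate_mem hC n l₂
  have hcap : part [(c, (none : Option (ℕ × L))), (c.flip, none)] [] ∈ C :=
    adjoint_part hC (pair_mem hC c none)
  -- The lower factor consists of identity strands with a cap between them. Starting the second
  -- index range at `n` keeps the strand labels disjoint, and `none` is reserved for the cap.
  have h' : part (separate 0 l₁ ++ ((c, none) :: (c.flip, none) :: separate n l₂))
      (separate 0 l₁ ++ separate n l₂) ∈ C := by
    refine tensor_part hC hsep1 (tensor_part hC hcap hsep2 ?_) ?_
    · rintro t ht ht'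
      simp only [or_self] at ht'
      obtain ⟨i, t', rfl, -⟩ := separate_occurs ht'
      simp at ht
    · rintro t ht ht'
      simp only [or_self] at ht
      obtain ⟨i, t', rfl, -, h2, -⟩ := separate_occurs ht
      simp only [occurs_cons, reduceCtorEq, false_or, or_self] at ht'
      obtain ⟨j, t'', e, h3, -⟩ := separate_occurs ht'
      simp only [Option.some.injEq, Prod.mk.injEq] at e
      omega
  have hrel : ∀ k v, relabel (fun k : Option (ℕ × L) => k.elim (f s) fun k => f k.2)
      (separate k v) = relabel f v := fun k v => relabel_separate k v f (f s)
  have := compose_part hC h h' f (fun k => k.elim (f s) fun k => f k.2) (by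
    simp only [relabel, List.map_append, List.map_cons] at hrel ⊢
    rw [hrel, hrel]
    simp [hs]) ?_
  · simpa only [relabel, List.map_append, hrel] using this
  set G := Glued (l₁ ++ (c, s) :: (c.flip, s') :: l₂)
    (separate 0 l₁ ++ ((c, none) :: (c.flip, none) :: separate n l₂))
  have hzip : ((l₁ ++ (c, s) :: (c.flip, s') :: l₂).map Prod.snd).zip
      ((separate 0 l₁ ++ ((c, none) :: (c.flip, none) :: separate n l₂)).map Prod.snd) =
      (l₁.map Prod.snd).zip ((separate 0 l₁).map Prod.snd) ++ (s, none) :: (s', none) ::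
        (l₂.map Prod.snd).zip ((separate n l₂).map Prod.snd) := by
    rw [List.map_append, List.map_append, List.zip_append (by simp [separate_length])]
    rfl
  -- The cap joins `s` and `s'`.
  have hss : EqvGen G (Sum.inl s) (Sum.inl s') := by
    refine .trans _ (Sum.inr none) _ (.rel _ _ ⟨s, none, rfl, rfl, ?_⟩)
      (.symm _ _ (.rel _ _ ⟨s', none, rfl, rfl, ?_⟩)) <;> rw [hzip] <;> simp
  have hll : ∀ a b, f a = f b → EqvGen G (Sum.inl a) (Sum.inl b) := by
    intro a b hab
    rcases hf a b hab with rfl | ⟨rfl, rfl⟩ | ⟨rfl, rfl⟩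
    · exact .refl _
    · exact hss
    · exact .symm _ _ hss
  -- Following a strand upwards replaces any outer label by one of the upper factor.
  have hub : ∀ j, Sum.elim (Occurs · u) (Occurs · (separate 0 l₁ ++ separate n l₂)) j →
      ∃ a, EqvGen G j (Sum.inl a) ∧
        f a = Sum.elim f (fun k : Option (ℕ × L) => k.elim (f s) fun k => f k.2) j := by
    rintro (a | k) hj
    · exact ⟨a, .refl _, rfl⟩
    · rcases (occurs_append _ _ _).1 hj with hj | hj <;>
      · obtain ⟨i, t, rfl, -, -, hz⟩ := separate_occurs hj
        refine ⟨t, .symm _ _ (.rel _ _ ⟨t, _, rfl, rfl, ?_⟩), rfl⟩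
        rw [hzip]
        simp [hz]
  intro j k hj hk e
  obtain ⟨a, ha, ha'⟩ := hub j hj
  obtain ⟨b, hb, hb'⟩ := hub k hk
  exact .trans _ _ _ ha (.trans _ _ _ (hll a b (by rw [ha', hb', e])) (.symm _ _ hb))

theorem option_elim_merge (t : L) (a b : Option L)
    (h : a.elim t id = b.elim t id) :
    a = b ∨ (a = none ∧ b = some t) ∨ (a = some t ∧ b = none) := by
  cases a <;> cases b <;> simp_all

theorem relabel_elim_some (t : L) (u : List (Color × L)) :
    relabel (fun k : Option L => k.elim t id) (relabel some u) = u := by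
  simp [relabel, Function.comp_def, Prod.map]

theorem not_occurs_none (u : List (Color × L)) : ¬ Occurs none (relabel some u) := by
  simp [Occurs]

/-- Rotation of the leftmost lower point to the upper row. -/
theorem rotate_left_up (hC : IsCategory C) {u l : List (Color × L)} {c : Color} {t : L}
    (h : part u ((c, t) :: l) ∈ C) : part ((c.flip, t) :: u) l ∈ C := by
  rw [← part_relabel (Option.some_injective L)] at h
  -- The lower end of the new strand, with fresh label `none`, is contracted with the point; its
  -- upper end becomes the rotated point.
  have h' := tensor_part hC (id_mem hC c.flip none) h (by
    rintro k hk hk'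
    simp only [occurs_cons, occurs_nil, or_false, or_self] at hk
    subst hk
    exact hk'.elim (not_occurs_none _) (not_occurs_none _))
  have := contract hC (l₁ := []) (l₂ := relabel some l) (c := c.flip) (s := none) (s' := some t)
    (by simpa using h') (fun k => k.elim t id) rfl (fun a b e => by
      have := option_elim_merge t a b e; tauto)
  change part ((c.flip, t) :: relabel _ (relabel some u)) (relabel _ (relabel some l)) ∈ C at this
  rwa [relabel_elim_some, relabel_elim_some] at this

/-- Rotation of the rightmost lower point to the upper row. -/
theorem rotate_right_up (hC : IsCategory C) {u l : List (Color × L)} {c : Color} {t : L}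
    (h : part u (l ++ [(c, t)]) ∈ C) : part (u ++ [(c.flip, t)]) l ∈ C := by
  rw [← part_relabel (Option.some_injective L)] at h
  have h' := tensor_part hC h (id_mem hC c.flip none) (by
    rintro k hk hk'
    simp only [occurs_cons, occurs_nil, or_false, or_self] at hk'
    subst hk'
    exact hk.elim (not_occurs_none _) (not_occurs_none _))
  have := contract hC (l₁ := relabel some l) (l₂ := []) (c := c) (s := some t) (s' := none)
    (by simpa using h') (fun k => k.elim t id) rfl (fun a b e => by
      have := option_elim_merge t a b e; tauto)
  rw [List.append_nil, relabel_elim_some, relabel, List.map_append] at this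
  change part (relabel _ (relabel some u) ++ [(c.flip, t)]) l ∈ C at this
  rwa [relabel_elim_some] at this

theorem rotate_left_down (hC : IsCategory C) {u l : List (Color × L)} {c : Color} {t : L}
    (h : part ((c, t) :: u) l ∈ C) : part u ((c.flip, t) :: l) ∈ C :=
  adjoint_part hC (rotate_left_up hC (adjoint_part hC h))

theorem rotate_right_down (hC : IsCategory C) {u l : List (Color × L)} {c : Color} {t : L}
    (h : part (u ++ [(c, t)]) l ∈ C) : part u (l ++ [(c.flip, t)]) ∈ C :=
  adjoint_part hC (rotate_right_up hC (adjoint_part hC h))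

/-- The row that is rotated by a half turn. -/
def turn (u : List (Color × L)) : List (Color × L) := (u.map (Prod.map Color.flip id)).reverse

theorem turn_left_up (hC : IsCategory C) {u l v : List (Color × L)}
    (h : part u (v ++ l) ∈ C) : part (turn v ++ u) l ∈ C := by
  induction v generalizing u with
  | nil => exact h
  | cons x v ih => simpa [turn, Prod.map] using ih (rotate_left_up hC h)

theorem turn_right_up (hC : IsCategory C) {u l v : List (Color × L)}
    (h : part u (l ++ v) ∈ C) : part (u ++ turn v) l ∈ C := by
  induction v generalizing l with
  | nil => simpa [turn] using h
  | cons x v ih =>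
    have := rotate_right_up hC (ih (l := l ++ [x]) (by simpa using h))
    simpa [turn, Prod.map] using this

theorem turn_left_down (hC : IsCategory C) {u l v : List (Color × L)}
    (h : part (v ++ u) l ∈ C) : part u (turn v ++ l) ∈ C :=
  adjoint_part hC (turn_left_up hC (adjoint_part hC h))

theorem occurs_turn {t : L} {u : List (Color × L)} : Occurs t (turn u) ↔ Occurs t u := by
  simp [Occurs, turn]

open Classical in
/-- The composition of a partition with its adjoint. Only the labels that occur in the middle row
are shared by both copies. -/
theorem compose_adjoint (hC : IsCategory C) {u l : List (Color × L)} (h : part u l ∈ C) :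
    part (relabel (fun t => (t, decide (Occurs t u))) l) (relabel (fun t => (t, true)) l) ∈ C := by
  refine compose_part hC (adjoint_part hC h) h _ _ ?_ ?_
  -- Every label of the middle row occurs in `u`, so both copies carry the flag `true` there.
  · refine List.map_congr_left fun x hx => ?_
    have : Occurs x.2 u := List.mem_map_of_mem hx
    simp [Prod.map, this]
  · have edge : ∀ t, Occurs t u → EqvGen (Glued u u) (Sum.inl t) (Sum.inr t) := by
      intro t ht
      refine .rel _ _ ⟨t, t, rfl, rfl, ?_⟩
      obtain ⟨i, hi, rfl⟩ := List.getElem_of_mem ht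
      exact List.mem_iff_getElem.2 ⟨i, by simpa using hi, by simp⟩
    rintro (a | a) (b | b) - - e <;>
      simp only [Sum.elim_inl, Sum.elim_inr, Prod.mk.injEq, decide_eq_true_eq, and_true,
        eq_comm (a := true)] at e
    · obtain ⟨rfl, -⟩ := e
      exact .refl _
    · obtain ⟨rfl, ha⟩ := e
      exact edge _ ha
    · obtain ⟨rfl, ha⟩ := e
      exact .symm _ _ (edge _ ha)
    · subst e
      exact .refl _

end Rotation

/-! ### Block sizes -/

section BlockSizes

variable {L M : Type} {C : Set Partition}

open Classical in
/-- The number of points of a row with a given label. -/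
noncomputable def mult (t : L) (u : List (Color × L)) : ℕ := (u.map Prod.snd).count t

@[simp] theorem mult_nil (t : L) : mult t [] = 0 := by simp [mult]

open Classical in
theorem mult_cons (t : L) (x : Color × L) (u : List (Color × L)) :
    mult t (x :: u) = mult t u + if x.2 = t then 1 else 0 := by
  simp [mult, List.count_cons]

@[simp] theorem mult_append (t : L) (u v : List (Color × L)) :
    mult t (u ++ v) = mult t u + mult t v := by simp [mult]

theorem mult_turn (t : L) (u : List (Color × L)) : mult t (turn u) = mult t u := by
  simp [mult, turn, Function.comp_def]

theorem mult_pos {t : L} {u : List (Color × L)} : 0 < mult t u ↔ Occurs t u := by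
  simp [mult, Occurs, List.count_pos_iff]

theorem ncard_row (t : L) (u : List (Color × L)) :
    {i | rowLabel u i = t}.ncard = mult t u := by
  classical
  rw [Set.ncard_eq_toFinset_card']
  simp only [Set.toFinset_ofPred]
  induction u with
  | nil => rfl
  | cons x u ih =>
    rw [mult_cons, ← ih, add_comm]
    exact Fin.card_filter_univ_succ' (fun i => rowLabel (x :: u) i = t)

theorem ncard_label (t : L) (u l : List (Color × L)) :
    {z | label u l z = t}.ncard = mult t u + mult t l := by
  rw [← ncard_row, ← ncard_row,
    ← Set.ncard_image_of_injective {i | rowLabel u i = t} Sum.inl_injective,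
    ← Set.ncard_image_of_injective {i | rowLabel l i = t} Sum.inr_injective,
    ← Set.ncard_union_eq]
  · congr 1
    ext (z | z) <;> simp [label]
  · rw [Set.disjoint_left]
    rintro _ ⟨x, -, rfl⟩ ⟨y, -, h⟩
    cases h

theorem mult_mem_blockSizes {u l : List (Color × L)} (h : part u l ∈ C) {t : L}
    (ht : 0 < mult t u + mult t l) : mult t u + mult t l ∈ blockSizes C := by
  rw [← ncard_label] at ht ⊢
  obtain ⟨z, hz⟩ := Set.nonempty_of_ncard_ne_zero ht.ne'
  refine ⟨part u l, h, _, ⟨z, rfl⟩, ?_⟩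
  subst hz
  rfl

theorem exists_mult_of_mem_blockSizes {n : ℕ} (hn : n ∈ blockSizes C) :
    ∃ (L : Type) (u l : List (Color × L)) (t : L), part u l ∈ C ∧ 0 < n ∧
      mult t u + mult t l = n := by
  obtain ⟨p, hp, B, ⟨z, rfl⟩, rfl⟩ := hn
  obtain ⟨L, u, l, rfl⟩ : ∃ (L : Type) (u l : List (Color × L)), part u l = p :=
    ⟨_, exists_part p⟩
  refine ⟨_, u, l, label u l z, hp, ?_, (ncard_label _ u l).symm⟩
  exact (Set.ncard_pos (Set.toFinite _)).2 ⟨z, rfl⟩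

theorem exists_split {t : L} {u : List (Color × L)} (h : Occurs t u) :
    ∃ v c w, u = v ++ (c, t) :: w ∧ mult t v = 0 := by
  obtain ⟨a, b, e, ha⟩ := List.eq_append_cons_of_mem h
  obtain ⟨v, w', rfl, rfl, hw⟩ := List.map_eq_append_iff.1 e
  obtain ⟨⟨c, s⟩, w, rfl, rfl, -⟩ := List.map_eq_cons_iff.1 hw
  refine ⟨v, c, w, rfl, ?_⟩
  by_contra h0
  exact ha (mult_pos.1 (Nat.pos_of_ne_zero h0))

/-- Every point of a partition can be made the only lower point. -/
theorem exists_single_lower (hC : IsCategory C) {u l : List (Color × L)} (h : part u l ∈ C) {t : L}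
    (ht : 0 < mult t u + mult t l) :
    ∃ w c, part w [(c, t)] ∈ C ∧ mult t w + 1 = mult t u + mult t l := by
  wlog hl : Occurs t l generalizing u l
  · have hu : Occurs t u := by
      rw [← mult_pos] at hl ⊢
      omega
    rw [add_comm] at ht ⊢
    exact this (adjoint_part hC h) ht hu
  obtain ⟨v, c, w, rfl, hv⟩ := exists_split hl
  refine ⟨turn v ++ u ++ turn w, c, turn_right_up (l := [(c, t)]) hC (turn_left_up hC h), ?_⟩
  simp only [mult_append, mult_turn, mult_cons, if_true]
  omega

/-- With the singleton as the only lower point, its block does not meet the upper row, so doubling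
leaves two unconnected points. -/
theorem singles_mem (hC : IsCategory C) (h : 1 ∈ blockSizes C) : singles ∈ C := by
  obtain ⟨L, u, l, t, hp, h0, h1⟩ := exists_mult_of_mem_blockSizes h
  obtain ⟨w, c, hw, hc⟩ := exists_single_lower hC hp (h1 ▸ h0)
  have hnot : ¬ Occurs t w := by
    rw [← mult_pos]
    omega
  have h2 := compose_adjoint hC hw
  simp only [relabel, List.map_cons, List.map_nil, Prod.map, id, hnot, decide_false] at h2
  -- The color decides on which side the upper point comes down to read white, black.
  cases c
  · have := rotate_right_down (u := []) hC h2
    rwa [singles_eq (s := (t, true)) (t := (t, false)) (by simp)]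
  · have := rotate_left_down hC h2
    rwa [singles_eq (s := (t, false)) (t := (t, true)) (by simp)]

theorem fourBlock_eq (t : L) : fourBlock =
    part [] [(Color.white, t), (Color.black, t), (Color.white, t), (Color.black, t)] := by
  rw [part_of_const (t := t) (by simp) (by simp)]
  rfl

/-- With three points available, two can be put below and one kept above, so the doubled block is
connected and has enough points to isolate two neighbors of opposite colors. Doubling these gives
four points in one block. -/
theorem fourBlock_mem (hC : IsCategory C) {n : ℕ} (hn : 3 ≤ n) (h : n ∈ blockSizes C) :
    fourBlock ∈ C := by
  obtain ⟨L, u, l, t, hp, h0, h1⟩ := exists_mult_of_mem_blockSizes h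
  obtain ⟨w, c, hw, hc⟩ := exists_single_lower hC hp (h1 ▸ h0)
  obtain ⟨w₁, d, w₂, rfl, hw₁⟩ := exists_split (mult_pos.1 (show 0 < mult t w by omega))
  simp only [mult_append, mult_cons, if_true] at hc
  -- As `w₁` avoids `t`, a third point of the block lies in `w₂`; it will connect the two copies.
  have hw₂ : Occurs t w₂ := mult_pos.1 (by omega)
  rw [List.append_cons] at hw
  have h2 := compose_adjoint hC (turn_left_down hC hw)
  have hv : Occurs t (turn (w₁ ++ [(d, t)])) := by simp [occurs_turn]
  generalize turn (w₁ ++ [(d, t)]) = v at h2 hv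
  simp only [relabel, List.map_append, List.map_cons, List.map_nil, Prod.map, id, hw₂,
    decide_true] at h2
  -- Only the marked point stays below; its mirror image at the upper right end then comes down with
  -- flipped color, while `v` keeps points of the block above.
  have h3 := turn_left_up hC h2
  rw [← List.append_assoc] at h3
  obtain ⟨x, hx, hxC⟩ : ∃ x, Occurs (t, true) x ∧
      part x [(c, (t, true)), (c.flip, (t, true))] ∈ C := by
    refine ⟨_, (occurs_append _ _ _).2 (Or.inl (occurs_turn.2 ?_)), rotate_right_down hC h3⟩
    simpa [Occurs, Function.comp_def] using hv
  have h4 := compose_adjoint hC hxC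
  simp only [relabel, List.map_cons, List.map_nil, Prod.map, id, hx, decide_true] at h4
  have h5 := rotate_left_down hC (rotate_left_down hC h4)
  rw [fourBlock_eq ((t, true), true)]
  cases c
  · exact h5
  -- For black, the row starts with the wrong color; one cyclic rotation corrects this.
  · exact rotate_left_down hC (rotate_right_up (u := [])
      (l := [(Color.black, _), (Color.white, _), (Color.black, _)]) hC h5)

/-! ### Realizing all block sizes -/

theorem relabel_append (f : L → M) (u v : List (Color × L)) :
    relabel f (u ++ v) = relabel f u ++ relabel f v := List.map_append

/-- The alternating row of length `2 * n` with constant labels. -/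
def alternating (t : L) : ℕ → List (Color × L)
  | 0 => []
  | n + 1 => alternating t n ++ [(Color.white, t), (Color.black, t)]

theorem relabel_alternating (f : L → M) (t : L) (n : ℕ) :
    relabel f (alternating t n) = alternating (f t) n := by
  induction n with
  | zero => rfl
  | succ n ih => simp only [relabel, alternating, List.map_append] at ih ⊢; rw [ih]; rfl

theorem occurs_alternating {s t : L} {n : ℕ} (h : Occurs s (alternating t n)) : s = t := by
  induction n with
  | zero => simp [alternating] at h
  | succ n ih =>
    simp only [alternating, occurs_append, occurs_cons, occurs_nil, or_false, or_self] at h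
    exact h.elim ih id

theorem mult_alternating (t : L) (n : ℕ) : mult t (alternating t n) = 2 * n := by
  induction n with
  | zero => simp [alternating]
  | succ n ih => simp [alternating, mult_cons, ih]; ring

/-- Appending a four block and contracting at the junction lengthens the block by two points. -/
theorem alternating_mem (hC : IsCategory C) (hf : fourBlock ∈ C) (t : L) (n : ℕ) :
    part [] (alternating t (n + 1)) ∈ C := by
  -- With labels in small finite types, `decide` verifies which labels a contraction merges.
  suffices h : part [] (alternating () (n + 1)) ∈ C by
    rw [← part_relabel (Function.injective_of_subsingleton fun _ : Unit => t),
      relabel_alternating] at h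
    exact h
  induction n with
  | zero => exact pair_mem hC .white ()
  | succ n ih =>
    rw [← part_relabel (Function.injective_of_subsingleton fun _ : Unit => false),
      relabel_alternating] at ih
    rw [fourBlock_eq true] at hf
    have h := tensor_part hC ih hf (by
      rintro s hs hs'
      have := occurs_alternating (hs.resolve_left (by simp))
      subst this
      simp at hs')
    have h' := contract hC (l₁ := alternating false n ++ [(Color.white, false)])
      (l₂ := [(Color.black, true), (Color.white, true), (Color.black, true)])
      (c := Color.black) (s := false) (s' := true) (u := [])
      (by simpa [alternating, Color.flip] using h) (fun _ => ()) rfl (by decide)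
    rw [relabel_append, relabel_append, relabel_alternating] at h'
    simpa [alternating] using h'

theorem even_mem_blockSizes (hC : IsCategory C) (hf : fourBlock ∈ C) (n : ℕ) :
    2 * (n + 1) ∈ blockSizes C := by
  have := mult_mem_blockSizes (t := ()) (alternating_mem hC hf () n) (by simp [mult_alternating])
  simpa [mult_alternating] using this

/-- Contracting the last point of a block of size `2 * (n + 1)` with the white singleton removes one
point; the black singleton, labelled `2`, stays separate. -/
theorem odd_mem_blockSizes (hC : IsCategory C) (hs : singles ∈ C) (hf : fourBlock ∈ C) (n : ℕ) :
    2 * n + 1 ∈ blockSizes C := by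
  rw [singles_eq (show (1 : Fin 3) ≠ 2 by decide)] at hs
  have h := tensor_part hC (alternating_mem hC hf (0 : Fin 3) n) hs (by
    rintro s hs hs'
    have := occurs_alternating (hs.resolve_left (by simp))
    subst this
    simp at hs')
  have h' := contract hC (l₁ := alternating 0 n ++ [(Color.white, 0)])
    (l₂ := [(Color.black, 2)]) (c := Color.black) (s := 0) (s' := 1) (u := [])
    (by simpa [alternating, Color.flip] using h) (![0, 0, 2] : Fin 3 → Fin 3) rfl (by decide)
  rw [relabel_append, relabel_append, relabel_alternating] at h'
  have := mult_mem_blockSizes (t := 0) h' (by simp [mult_cons])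
  simpa [mult_cons, mult_alternating] using this

theorem one_mem_blockSizes (hs : singles ∈ C) : 1 ∈ blockSizes C := by
  rw [singles_eq (show false ≠ true by decide)] at hs
  simpa [mult_cons] using mult_mem_blockSizes (t := false) hs (by simp [mult_cons])

theorem two_mem_blockSizes (hC : IsCategory C) : 2 ∈ blockSizes C := by
  simpa [mult_cons] using
    mult_mem_blockSizes (t := ()) (pair_mem hC .white ()) (by simp [mult_cons])

theorem pos_of_mem_blockSizes {n : ℕ} (hn : n ∈ blockSizes C) : 1 ≤ n := by
  obtain ⟨-, -, -, -, -, h, -⟩ := exists_mult_of_mem_blockSizes hn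
  exact h

/-! ### The three cases -/

theorem blockSizes_of_caseO (hC : IsCategory C) (h : CaseO C) : blockSizes C = {2} := by
  ext n
  refine ⟨fun hn => ?_, fun hn => hn ▸ two_mem_blockSizes hC⟩
  have h0 := pos_of_mem_blockSizes hn
  have h1 : n ≠ 1 := fun e => h.1 (singles_mem hC (e ▸ hn))
  have h3 : ¬ 3 ≤ n := fun h3 => h.2 (fourBlock_mem hC h3 hn)
  change n = 2
  omega

theorem blockSizes_of_caseB (hC : IsCategory C) (h : CaseB C) : blockSizes C = {1, 2} := by
  ext n
  constructor
  · intro hn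
    have h0 := pos_of_mem_blockSizes hn
    have h3 : ¬ 3 ≤ n := fun h3 => h.2 (fourBlock_mem hC h3 hn)
    change n = 1 ∨ n = 2
    omega
  · rintro (rfl | rfl)
    · exact one_mem_blockSizes h.1
    · exact two_mem_blockSizes hC

theorem blockSizes_of_caseS (hC : IsCategory C) (h : CaseS C) :
    blockSizes C = {n : ℕ | 1 ≤ n} := by
  ext n
  refine ⟨pos_of_mem_blockSizes, fun hn => ?_⟩
  rcases Nat.even_or_odd' n with ⟨k, rfl | rfl⟩
  · obtain ⟨k, rfl⟩ : ∃ j, k = j + 1 := Nat.exists_eq_succ_of_ne_zero (by rintro rfl; simp at hn)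
    exact even_mem_blockSizes hC h.2 k
  · exact odd_mem_blockSizes hC h.1 h.2 k

end BlockSizes

end TwoColored

theorem proposition4p3 (C : Set TwoColored.Partition) (hC : TwoColored.IsCategory C)
    (hNHO : TwoColored.NonHyperoctahedral C) :
    (TwoColored.blockSizes C = {2} ∨ TwoColored.blockSizes C = {1, 2} ∨
      TwoColored.blockSizes C = {n : ℕ | 1 ≤ n}) ∧
    (TwoColored.CaseO C → TwoColored.blockSizes C = {2}) ∧
    (TwoColored.CaseB C → TwoColored.blockSizes C = {1, 2}) ∧
    (TwoColored.CaseS C → TwoColored.blockSizes C = {n : ℕ | 1 ≤ n}) := by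
  have hO := TwoColored.blockSizes_of_caseO hC
  have hB := TwoColored.blockSizes_of_caseB hC
  have hS := TwoColored.blockSizes_of_caseS hC
  refine ⟨?_, hO, hB, hS⟩
  by_cases hs : TwoColored.singles ∈ C <;> by_cases hf : TwoColored.fourBlock ∈ C
  · exact Or.inr (Or.inr (hS ⟨hs, hf⟩))
  · exact Or.inr (Or.inl (hB ⟨hs, hf⟩))
  · exact absurd hNHO (by simp [TwoColored.NonHyperoctahedral, hs, hf])
  · exact Or.inl (hO ⟨hs, hf⟩)
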